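/- Index the Fibonacci numbers by $F_1=1$, $F_2=2$ and $F_{k+1}=F_k+F_{k-1}$ for $k\ge 2$. The Zeckendorf game on input $N$ is played on a multiset of Fibonacci numbers which initially consists of $N$ copies of $F_1$. The moves, each playable whenever the multiset contains the numbers (with multiplicity) that the move removes, are the combine moves $C_1: F_1\wedge F_1\to F_2$ and $C_k: F_{k-1}\wedge F_k\to F_{k+1}$ for $k\ge 2$, and the splitting moves $S_2: F_2\wedge F_2\to F_1\wedge F_3$ and $S_k: F_k\wedge F_k\to F_{k-2}\wedge F_{k+1}$ for $k\ge 3$. The two players alternate turns, Player 1 moving first, until no move is playable; the player who makes the last move wins. Let $\Omega_N$ be the (finite) set of all complete games on input $N$, a game being the sequence $\mathcal G=(M_1,\dots,M_\lambda)$ of its moves. Let $\mu_N$ be the uniform probability measure on $\Omega_N$, and let $\mathbb P_N$ be the probability measure on $\Omega_N$ that is induced by choosing each move uniformly at random among the playable ones, that is, $$\mathbb P_N(\mathcal G)=\prod_{k=1}^{\lambda}\frac{1}{\text{number of moves playable after }(M_1,\dots,M_{k-1})}.$$ Then $$\lim_{N\to\infty}\mu_N(\text{Player 1 wins})=\lim_{N\to\infty}\mu_N(\text{Player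 2 wins})=\frac12$$ and $$\lim_{N\to\infty}\mathbb P_N(\text{Player 1 wins})=\lim_{N\to\infty}\mathbb P_N(\text{Player 2 wins})=\frac12 .$$ -/

import Mathlib

open Filter Topology MeasureTheory

namespace ZeckendorfGame

/-- The Fibonacci numbers indexed so that `F 1 = 1`, `F 2 = 2`, `F (n + 1) = F n + F (n - 1)`. -/
def F (k : ℕ) : ℕ := Nat.fib (k + 1)

/-- The moves of the game: `C k` (for `k ≥ 1`) is the `k`-th combine move and
`S k` (for `k ≥ 2`) is the `k`-th splitting move. -/
inductive Move where
  | C (k : ℕ) (hk : 1 ≤ k)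
  | S (k : ℕ) (hk : 2 ≤ k)

/-- The multiset of Fibonacci numbers which a move removes from the board:
`C 1` removes `F 1, F 1`; for `k ≥ 2`, `C k` removes `F (k - 1), F k`; `S k` removes `F k, F k`. -/
def Move.consumed : Move → Multiset ℕ
  | .C k _ => if k = 1 then {F 1, F 1} else {F (k - 1), F k}
  | .S k _ => {F k, F k}

/-- The multiset of Fibonacci numbers which a move puts on the board:
`C k` puts `F (k + 1)`; `S 2` puts `F 1, F 3`; for `k ≥ 3`, `S k` puts `F (k - 2), F (k + 1)`. -/
def Move.produced : Move → Multiset ℕ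
  | .C k _ => {F (k + 1)}
  | .S k _ => if k = 2 then {F 1, F 3} else {F (k - 2), F (k + 1)}

/-- A move is playable on the board `B` if `B` contains, with multiplicity, what it removes. -/
def Playable (B : Multiset ℕ) (m : Move) : Prop := m.consumed ≤ B

/-- The board after playing `m` on the board `B`. -/
def play (B : Multiset ℕ) (m : Move) : Multiset ℕ := B - m.consumed + m.produced

/-- `IsGame B G`: the sequence of moves `G` is a complete game from the board `B`, i.e. each
move is playable when its turn comes, and no move is playable at the end. -/
def IsGame : Multiset ℕ → List Move → Prop
  | B, [] => ∀ m, ¬ Playable B m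
  | B, m :: G => Playable B m ∧ IsGame (play B m) G

/-- The board after a sequence of moves. -/
def after (B : Multiset ℕ) (G : List Move) : Multiset ℕ := G.foldl play B

/-- The number of moves that are playable on a board. -/
noncomputable def numPlayable (B : Multiset ℕ) : ℕ := {m | Playable B m}.ncard

/-- The initial board on input `N`: `N` copies of `F 1`. -/
def start (N : ℕ) : Multiset ℕ := Multiset.replicate N (F 1)

/-- The set of all games on input `N`, as a type. -/
abbrev Omega (N : ℕ) : Type := {G : List Move // IsGame (start N) G}

/-- The probability of the sequence of moves `G` when at each turn a move is chosen uniformly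
at random among the playable ones, starting from the board `B`. -/
noncomputable def weight (B : Multiset ℕ) (G : List Move) : ENNReal :=
  ∏ k ∈ Finset.range G.length, (1 : ENNReal) / (numPlayable (after B (G.take k)) : ENNReal)

/-! Helper facts: there are finitely many games (and at least one) on each input, and the
weights of the games sum to one. -/

/-- An auxiliary weight of a token, whose sum over the board drops with each move. -/
def tokenWeight (v : ℕ) : ℕ := if v = 1 then 4 else 2 * Nat.greatestFib v + 1

/-- The sum of the auxiliary weights of the tokens on the board. -/
def potential (B : Multiset ℕ) : ℕ := (B.map tokenWeight).sum

theorem tokenWeight_F_one : tokenWeight (F 1) = 4 := by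
  simp [tokenWeight, F]

theorem tokenWeight_F {k : ℕ} (hk : 2 ≤ k) : tokenWeight (F k) = 2 * k + 3 := by
  have h1 : F k ≠ 1 := by
    have h := Nat.fib_mono (show 3 ≤ k + 1 by omega)
    have h3 : Nat.fib 3 = 2 := by decide
    unfold F
    omega
  rw [tokenWeight, if_neg h1, F, Nat.greatestFib_fib (by omega)]
  ring

theorem potential_move (m : Move) : potential m.produced < potential m.consumed := by
  have h1 := tokenWeight_F_one
  cases m with
  | C k hk =>
    have h2 := tokenWeight_F (k := k + 1) (by omega)
    by_cases h : k = 1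
    · subst h
      simp [potential, Move.produced, Move.consumed, h1] at *
      omega
    · have h3 := tokenWeight_F (k := k) (by omega)
      by_cases h' : k = 2
      · subst h'
        simp [potential, Move.produced, Move.consumed, h1] at *
        omega
      · have h4 := tokenWeight_F (k := k - 1) (by omega)
        simp [potential, Move.produced, Move.consumed, h, h2, h3, h4]
        omega
  | S k hk =>
    have h2 := tokenWeight_F (k := k + 1) (by omega)
    have h3 := tokenWeight_F (k := k) (by omega)
    by_cases h : k = 2
    · subst h
      simp [potential, Move.produced, Move.consumed, h1] at *
      omega
    · by_cases h' : k = 3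
      · subst h'
        simp [potential, Move.produced, Move.consumed, h1] at *
        omega
      · have h4 := tokenWeight_F (k := k - 2) (by omega)
        simp [potential, Move.produced, Move.consumed, h, h2, h3, h4]
        omega

theorem potential_play {B : Multiset ℕ} {m : Move} (h : Playable B m) :
    potential (play B m) < potential B := by
  obtain ⟨D, rfl⟩ := Multiset.le_iff_exists_add.mp h
  have := potential_move m
  simp only [play, add_tsub_cancel_left]
  simp only [potential, Multiset.map_add, Multiset.sum_add] at *
  omega

/-- The index and the type of a move. -/
def Move.code : Move → ℕ × Bool
  | .C k _ => (k, true)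
  | .S k _ => (k, false)

theorem Move.code_injective : Function.Injective Move.code := by
  intro a b h
  cases a <;> cases b <;> simp_all [Move.code]

theorem finite_playable (B : Multiset ℕ) : {m | Playable B m}.Finite := by
  refine Set.Finite.of_injOn (f := Move.code)
    (t := Set.Iic (B.sum) ×ˢ Set.univ) ?_ (Move.code_injective.injOn)
    ((Set.finite_Iic _).prod Set.finite_univ)
  intro m hm
  have key : ∀ k, F k ∈ B → k ≤ B.sum := fun k hk =>
    le_trans (by have := Nat.le_fib_add_one (k + 1); simp only [F]; omega)
      (Multiset.le_sum_of_mem hk)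
  refine ⟨?_, trivial⟩
  cases m with
  | C k hk =>
    refine key k (Multiset.mem_of_le (show (Move.C k hk).consumed ≤ B from hm) ?_)
    by_cases h : k = 1
    · subst h; simp [Move.consumed]
    · simp [Move.consumed, h]
  | S k hk =>
    refine key k (Multiset.mem_of_le (show (Move.S k hk).consumed ≤ B from hm) ?_)
    simp [Move.consumed]

theorem finite_games (B : Multiset ℕ) : {G | IsGame B G}.Finite := by
  induction hn : potential B using Nat.strong_induction_on generalizing B with
  | _ n ih =>
    subst hn
    have h : {G | IsGame B G} ⊆
        {[]} ∪ ⋃ m ∈ {m | Playable B m}, (List.cons m) '' {G | IsGame (play B m) G} := by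
      rintro (_ | ⟨m, G⟩) hG
      · simp
      · right
        simp only [Set.mem_iUnion]
        exact ⟨m, hG.1, G, hG.2, rfl⟩
    refine Set.Finite.subset ((Set.finite_singleton _).union
      ((finite_playable B).biUnion fun m hm => Set.Finite.image _ ?_)) h
    exact ih _ (potential_play hm) _ rfl

theorem weight_nil (B : Multiset ℕ) : weight B [] = 1 := by
  simp [weight]

theorem weight_cons (B : Multiset ℕ) (m : Move) (G : List Move) :
    weight B (m :: G) = (numPlayable B : ENNReal)⁻¹ * weight (play B m) G := by
  simp [weight, Finset.prod_range_succ', after, mul_comm]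

theorem sum_weight (B : Multiset ℕ) : ∑' G : {G // IsGame B G}, weight B G = 1 := by
  induction hn : potential B using Nat.strong_induction_on generalizing B with
  | _ n ih =>
    subst hn
    by_cases h : ∃ m, Playable B m
    · let e : {G // IsGame B G} ≃ Σ m : {m // Playable B m}, {G // IsGame (play B m) G} :=
        { toFun := fun G => match G with
            | ⟨[], hG⟩ => absurd h (not_exists.mpr hG)
            | ⟨m :: G, hG⟩ => ⟨⟨m, hG.1⟩, ⟨G, hG.2⟩⟩
          invFun := fun x => ⟨x.1.1 :: x.2.1, x.1.2, x.2.2⟩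
          left_inv := by
            rintro ⟨_ | ⟨m, G⟩, hG⟩
            · exact absurd h (not_exists.mpr hG)
            · rfl
          right_inv := by
            rintro ⟨⟨m, hm⟩, ⟨G, hG⟩⟩
            rfl }
      rw [← e.symm.tsum_eq,
        ENNReal.tsum_sigma' (fun x => weight B (e.symm x).1)]
      have h1 : ∀ m : {m // Playable B m},
          ∑' G : {G // IsGame (play B m) G}, weight B (e.symm ⟨m, G⟩).1
            = (numPlayable B : ENNReal)⁻¹ := by
        intro m
        have h2 : ∀ G : {G // IsGame (play B m) G}, weight B (e.symm ⟨m, G⟩).1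
            = (numPlayable B : ENNReal)⁻¹ * weight (play B m) G := fun G => weight_cons _ _ _
        simp_rw [h2]
        rw [ENNReal.tsum_mul_left, ih _ (potential_play m.2) _ rfl, mul_one]
      simp_rw [h1]
      have hf : Finite {m // Playable B m} := finite_playable B
      have := Fintype.ofFinite {m // Playable B m}
      have hc : numPlayable B = Fintype.card {m // Playable B m} := by
        rw [← Nat.card_eq_fintype_card]
        rfl
      have hpos : Nonempty {m // Playable B m} := ⟨⟨h.choose, h.choose_spec⟩⟩
      rw [tsum_fintype, Finset.sum_const, Finset.card_univ, hc, nsmul_eq_mul]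
      exact ENNReal.mul_inv_cancel (by simp) (by simp)
    · push Not at h
      rw [tsum_eq_single ⟨[], h⟩, weight_nil]
      rintro ⟨_ | ⟨m, G⟩, hG⟩ hne
      · simp at hne
      · exact absurd hG.1 (h m)

noncomputable instance instFintypeOmega (N : ℕ) : Fintype (Omega N) :=
  (finite_games (start N)).fintype

instance instNonemptyOmega (N : ℕ) : Nonempty (Omega N) := by
  by_contra h
  have h' := not_nonempty_iff.mp h
  have := sum_weight (start N)
  simp at this

/-- Every set of games is an event. -/
instance instMeasurableSpaceOmega (N : ℕ) : MeasurableSpace (Omega N) := ⊤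

/-- The uniform probability measure on the set of all games on input `N`. -/
noncomputable def mu (N : ℕ) : Measure (Omega N) := (PMF.uniformOfFintype (Omega N)).toMeasure

/-- The probability mass function on the set of all games on input `N` that is induced by choosing
at each turn uniformly at random among the playable moves. -/
noncomputable def randomPlay (N : ℕ) : PMF (Omega N) :=
  ⟨fun G => weight (start N) G.1, by rw [← sum_weight (start N)]; exact ENNReal.summable.hasSum⟩

/-- The probability measure of the mass function `randomPlay N`. -/
noncomputable def P (N : ℕ) : Measure (Omega N) := (randomPlay N).toMeasure

/-- The two players. -/
inductive Player where
  | one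
  | two

/-- The player who makes the move number `t + 1` of the game: the players alternate turns, and
player one starts. -/
def mover (t : ℕ) : Player := if Even t then .one else .two

/-- A player wins a game if they make its last move. -/
def Wins (p : Player) (G : List Move) : Prop := ∃ t, G.length = t + 1 ∧ mover t = p

end ZeckendorfGame

/-! Player 1 wins exactly the games of odd length, so in both cases the claim is that the
expectation of `(-1) ^ length` tends to `0`. Both arguments use one cancellation: playing `C₁` and
then `S₂` leads to the same board as `C₂`, with one move more.

For the uniform measure the cancellation is almost complete. On boards holding only tokens `1` and
`2`, `signedCountSplit` satisfies a one-term recursion (`signedCountSplit_eq`), which exchanges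
pairs of `1`s for `2`s until at most one `1` is left. The signed count from `start N` is then `0`
for even `N ≥ 4`. For `N = 2 * m + 1 ≥ 5` it is, up to sign, the signed count of a single board,
which can be reached from `start N` along at least `m` different sequences of moves
(`mul_card_games_le`). Hence the expectation is at most `1 / (N / 2)` in absolute value.

For random play the two routes carry different probabilities, so each use only gains a factor `1 - 2
/ K ^ 3`, where `K` bounds the number of playable moves (`abs_signedWeight_le_of_four_ones`). Early
in the game all tokens are small, so `K` is logarithmic in the number of moves made
(`Early.card_moves_le`). The gain can therefore be iterated far more than `K ^ 3` times, and the
product of the factors tends to `0`. -/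

namespace ZeckendorfGame

/-! ### Finite sums over games, and the three moves on small tokens -/

/-- The games from a board, as a finite set. -/
noncomputable def games (B : Multiset ℕ) : Finset (List Move) := (finite_games B).toFinset

/-- The moves that are playable on a board, as a finite set. -/
noncomputable def moves (B : Multiset ℕ) : Finset Move := (finite_playable B).toFinset

@[simp] theorem mem_games {B : Multiset ℕ} {G : List Move} : G ∈ games B ↔ IsGame B G := by
  simp [games]

@[simp] theorem mem_moves {B : Multiset ℕ} {m : Move} : m ∈ moves B ↔ Playable B m := by
  simp [moves]

theorem card_moves (B : Multiset ℕ) : (moves B).card = numPlayable B := by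
  rw [numPlayable, Set.ncard_eq_toFinset_card _ (finite_playable B)]
  rfl

theorem games_of_moves_eq_empty {B : Multiset ℕ} (h : moves B = ∅) : games B = {[]} := by
  have h' : ∀ m, ¬ Playable B m := fun m hm => by
    have := mem_moves.2 hm
    simp [h] at this
  ext G
  cases G with
  | nil => simpa [IsGame] using h'
  | cons m G => simp [IsGame, h' m]

/-- Sums over the games from a board, split according to the first move. -/
theorem sum_games {M : Type*} [AddCommMonoid M] {B : Multiset ℕ} (h : (moves B).Nonempty)
    (f : List Move → M) :
    ∑ G ∈ games B, f G = ∑ m ∈ moves B, ∑ G ∈ games (play B m), f (m :: G) := by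
  rw [Finset.sum_sigma']
  symm
  refine Finset.sum_bij (fun x _ => x.1 :: x.2) ?_ ?_ ?_ ?_
  · rintro ⟨m, G⟩ hx
    simpa [IsGame] using hx
  · rintro ⟨m, G⟩ - ⟨m', G'⟩ - h
    simp only [List.cons.injEq] at h
    obtain ⟨rfl, rfl⟩ := h
    rfl
  · rintro (_ | ⟨m, G⟩) hG
    · obtain ⟨m, hm⟩ := h
      exact absurd (mem_moves.1 hm) (mem_games.1 hG m)
    · exact ⟨⟨m, G⟩, by simpa [IsGame] using hG, rfl⟩
  · intros
    rfl

theorem play_consumed_add (D : Multiset ℕ) (m : Move) :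
    play (m.consumed + D) m = D + m.produced := by
  simp [play]

/-- The first combine move. -/
abbrev C₁ : Move := .C 1 le_rfl

/-- The second combine move. -/
abbrev C₂ : Move := .C 2 one_le_two

/-- The first splitting move. -/
abbrev S₂ : Move := .S 2 le_rfl

theorem F_one : F 1 = 1 := rfl
theorem F_two : F 2 = 2 := rfl
theorem F_three : F 3 = 3 := rfl

theorem playable_C₁ (D : Multiset ℕ) : Playable ({1, 1} + D) C₁ := by
  simp [Playable, Move.consumed, F_one]

theorem playable_C₂ (D : Multiset ℕ) : Playable ({1, 2} + D) C₂ := by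
  simp [Playable, Move.consumed, F_one, F_two]

theorem playable_S₂ (D : Multiset ℕ) : Playable ({2, 2} + D) S₂ := by
  simp [Playable, Move.consumed, F_two]

theorem play_C₁ (D : Multiset ℕ) : play ({1, 1} + D) C₁ = D + {2} := by
  simpa [Move.consumed, Move.produced, F_one, F_two] using play_consumed_add D C₁

theorem play_C₂ (D : Multiset ℕ) : play ({1, 2} + D) C₂ = D + {3} := by
  simpa [Move.consumed, Move.produced, F_one, F_two, F_three] using play_consumed_add D C₂

theorem play_S₂ (D : Multiset ℕ) : play ({2, 2} + D) S₂ = D + {1, 3} := by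
  simpa [Move.consumed, Move.produced, F_one, F_two, F_three] using play_consumed_add D S₂

/-! ### Signed counts of games -/

/-- The number of games of even length minus the number of games of odd length. -/
noncomputable def signedCount (B : Multiset ℕ) : ℤ := ∑ G ∈ games B, (-1) ^ G.length

theorem signedCount_eq {B : Multiset ℕ} (h : (moves B).Nonempty) :
    signedCount B = -∑ m ∈ moves B, signedCount (play B m) := by
  rw [signedCount, sum_games h, ← Finset.sum_neg_distrib]
  simp [signedCount, pow_succ]

theorem card_games {B : Multiset ℕ} (h : (moves B).Nonempty) :
    (games B).card = ∑ m ∈ moves B, (games (play B m)).card := by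
  simp only [Finset.card_eq_sum_ones]
  exact sum_games h _

theorem card_games_play_le {B : Multiset ℕ} {m : Move} (hm : Playable B m) :
    (games (play B m)).card ≤ (games B).card := by
  rw [card_games ⟨m, mem_moves.2 hm⟩]
  exact Finset.single_le_sum (f := fun m => (games (play B m)).card) (fun _ _ => Nat.zero_le _)
    (mem_moves.2 hm)

theorem abs_signedCount_le (B : Multiset ℕ) : |signedCount B| ≤ (games B).card := by
  refine (Finset.abs_sum_le_sum_abs _ _).trans ?_
  simp

/-! ### Moves on boards with tokens `1` and `2` only -/

/-- The board with `a` tokens of value `1` and `b` tokens of value `2`. -/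
def lowBoard (a b : ℕ) : Multiset ℕ := Multiset.replicate a 1 + Multiset.replicate b 2

theorem F_mem_consumed_C {k : ℕ} (hk : 1 ≤ k) : F k ∈ (Move.C k hk).consumed := by
  by_cases h : k = 1
  · subst h; simp [Move.consumed]
  · simp [Move.consumed, h]

theorem F_mem_consumed_S {k : ℕ} (hk : 2 ≤ k) : F k ∈ (Move.S k hk).consumed := by
  simp [Move.consumed]

theorem F_mono : Monotone F := fun _ _ h => Nat.fib_mono (by omega)

theorem eq_of_playable_lowBoard {a b : ℕ} {m : Move} (h : Playable (lowBoard a b) m) :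
    m = C₁ ∨ m = C₂ ∨ m = S₂ := by
  have key : ∀ k, F k ∈ lowBoard a b → k < 3 := fun k hk => by
    by_contra! h3
    have h1 : 3 ≤ F k := F_mono h3
    simp only [lowBoard, Multiset.mem_add, Multiset.mem_replicate] at hk
    omega
  cases m with
  | C k hk =>
    have := key k (Multiset.mem_of_le h (F_mem_consumed_C hk))
    obtain rfl | rfl : k = 1 ∨ k = 2 := by omega
    · simp
    · simp
  | S k hk =>
    have := key k (Multiset.mem_of_le h (F_mem_consumed_S hk))
    obtain rfl : k = 2 := by omega
    simp

theorem playable_lowBoard_C₁ {a b : ℕ} : Playable (lowBoard a b) C₁ ↔ 2 ≤ a := by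
  simp only [Playable, Move.consumed, lowBoard, F_one, if_true, Multiset.le_iff_count]
  constructor
  · intro h
    simpa [Multiset.count_replicate] using h 1
  · intro h v
    by_cases hv : v = 1
    · subst hv; simpa [Multiset.count_replicate] using h
    · simp [hv]

theorem playable_lowBoard_C₂ {a b : ℕ} : Playable (lowBoard a b) C₂ ↔ 1 ≤ a ∧ 1 ≤ b := by
  simp only [Playable, Move.consumed, lowBoard, Multiset.le_iff_count]
  constructor
  · intro h
    have h1 := h 1
    have h2 := h 2
    simpa [Multiset.count_replicate, F_one, F_two, Multiset.count_singleton] using And.intro h1 h2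
  · intro h v
    by_cases hv : v = 1
    · subst hv; simpa [Multiset.count_replicate, F_one, F_two] using h.1
    · by_cases hv' : v = 2
      · subst hv'; simpa [Multiset.count_replicate, F_one, F_two] using h.2
      · simp [F_one, F_two, hv, hv']

theorem playable_lowBoard_S₂ {a b : ℕ} : Playable (lowBoard a b) S₂ ↔ 2 ≤ b := by
  simp only [Playable, Move.consumed, lowBoard, F_two, Multiset.le_iff_count]
  constructor
  · intro h
    simpa [Multiset.count_replicate] using h 2
  · intro h v
    by_cases hv : v = 2
    · subst hv; simpa [Multiset.count_replicate] using h
    · simp [hv]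

theorem lowBoard_add_two_left (a b : ℕ) : lowBoard (a + 2) b = {1, 1} + lowBoard a b := by
  simp [lowBoard, Multiset.replicate_succ]

theorem lowBoard_add_two_right (a b : ℕ) : lowBoard a (b + 2) = {2, 2} + lowBoard a b := by
  simp [lowBoard, Multiset.replicate_succ]

theorem lowBoard_succ_succ (a b : ℕ) : lowBoard (a + 1) (b + 1) = {1, 2} + lowBoard a b := by
  simp only [lowBoard, Multiset.replicate_succ, Multiset.insert_eq_cons, Multiset.cons_add,
    Multiset.singleton_add, Multiset.add_cons]
  exact Multiset.cons_swap _ _ _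

theorem play_lowBoard_C₁ (a b : ℕ) : play (lowBoard (a + 2) b) C₁ = lowBoard a (b + 1) := by
  rw [lowBoard_add_two_left, play_C₁]
  simp [lowBoard, Multiset.replicate_succ, Multiset.add_cons, add_comm _ ({2} : Multiset ℕ)]

theorem play_lowBoard_C₂ (a b : ℕ) : play (lowBoard (a + 1) (b + 1)) C₂ = lowBoard a b + {3} := by
  rw [lowBoard_succ_succ, play_C₂]

theorem play_lowBoard_S₂ (a b : ℕ) :
    play (lowBoard a (b + 2)) S₂ = lowBoard (a + 1) b + {3} := by
  rw [lowBoard_add_two_right, play_S₂]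
  simp [lowBoard, Multiset.replicate_succ, Multiset.add_cons, add_comm _ ({3} : Multiset ℕ)]

open scoped Classical in
theorem moves_lowBoard (a b : ℕ) :
    moves (lowBoard a b) = (if 2 ≤ a then {C₁} else ∅) ∪ (if 1 ≤ a ∧ 1 ≤ b then {C₂} else ∅) ∪
      (if 2 ≤ b then {S₂} else ∅) := by
  have h1 := playable_lowBoard_C₁ (a := a) (b := b)
  have h2 := playable_lowBoard_C₂ (a := a) (b := b)
  have h3 := playable_lowBoard_S₂ (a := a) (b := b)
  ext m
  rw [mem_moves]
  by_cases hm : m = C₁ ∨ m = C₂ ∨ m = S₂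
  · rcases hm with rfl | rfl | rfl
    · rw [h1]; split_ifs <;> simp_all
    · rw [h2]; split_ifs <;> simp_all
    · rw [h3]; split_ifs <;> simp_all
  · have : ¬ Playable (lowBoard a b) m := fun h => hm (eq_of_playable_lowBoard h)
    push Not at hm
    split_ifs <;> simp_all

/-! ### Cancellation in the uniform case -/

/-- The signed count on low boards with its value after the first splitting move added. -/
noncomputable def signedCountSplit (a b : ℕ) : ℤ :=
  signedCount (lowBoard a b) + if 2 ≤ b then signedCount (play (lowBoard a b) S₂) else 0

/-- Expanding the signed count by the first move, the added `S₂` term cancels the contribution of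
`S₂`. What remains are the boards after `C₁` and after `C₂`, and the latter is also the board after
`C₁` and then `S₂`. -/
theorem signedCountSplit_eq (a b : ℕ) :
    signedCountSplit (a + 2) b = -signedCountSplit a (b + 1) := by
  have hne : (moves (lowBoard (a + 2) b)).Nonempty :=
    ⟨C₁, mem_moves.2 (playable_lowBoard_C₁.2 (by omega))⟩
  rw [signedCountSplit, signedCount_eq hne, moves_lowBoard, signedCountSplit]
  -- The cases are those in which neither `C₂` nor `S₂`, only `C₂`, or both are playable besides
  -- `C₁`.
  obtain _ | _ | b := b
  · simp [play_lowBoard_C₁]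
  · simp [play_lowBoard_C₁, play_lowBoard_C₂, play_lowBoard_S₂]
  · simp [play_lowBoard_C₁, play_lowBoard_C₂, play_lowBoard_S₂]
    ring

theorem signedCountSplit_add_two_mul (a b m : ℕ) :
    signedCountSplit (a + 2 * m) b = (-1) ^ m * signedCountSplit a (b + m) := by
  induction m generalizing b with
  | zero => simp
  | succ m ih =>
    rw [show a + 2 * (m + 1) = a + 2 * m + 2 by ring, signedCountSplit_eq, ih]
    rw [show b + 1 + m = b + (m + 1) by ring]
    ring

theorem start_eq_lowBoard (N : ℕ) : start N = lowBoard N 0 := by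
  simp [start, lowBoard, F_one]

theorem signedCount_start (N : ℕ) : signedCount (start N) = signedCountSplit N 0 := by
  simp [start_eq_lowBoard, signedCountSplit]

/-- The recursion ends at `m` tokens `2` and no `1`. There `S₂` is the only move, so the two terms
of `signedCountSplit` are opposite. -/
theorem signedCount_start_even {m : ℕ} (hm : 2 ≤ m) : signedCount (start (2 * m)) = 0 := by
  obtain ⟨b, rfl⟩ := Nat.exists_eq_add_of_le' hm
  have h := signedCountSplit_add_two_mul 0 0 (b + 2)
  rw [zero_add, zero_add] at h
  have hne : (moves (lowBoard 0 (b + 2))).Nonempty :=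
    ⟨S₂, mem_moves.2 (playable_lowBoard_S₂.2 (by omega))⟩
  rw [signedCount_start, h, signedCountSplit, signedCount_eq hne, moves_lowBoard]
  simp

/-- The recursion ends with one token `1` left. There only `C₂` and `S₂` are playable, and
cancelling the `S₂` term leaves the board after `C₂`. -/
theorem abs_signedCount_start_odd {m : ℕ} (hm : 2 ≤ m) :
    |signedCount (start (2 * m + 1))| ≤ (games (lowBoard 0 (m - 1) + {3})).card := by
  obtain ⟨b, rfl⟩ := Nat.exists_eq_add_of_le' hm
  have h := signedCountSplit_add_two_mul 1 0 (b + 2)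
  rw [zero_add] at h
  have hne : (moves (lowBoard 1 (b + 2))).Nonempty :=
    ⟨S₂, mem_moves.2 (playable_lowBoard_S₂.2 (by omega))⟩
  have h2 : signedCountSplit 1 (b + 2) = -signedCount (lowBoard 0 (b + 1) + {3}) := by
    rw [signedCountSplit, signedCount_eq hne, moves_lowBoard, ← play_lowBoard_C₂]
    simp
  rw [signedCount_start, add_comm, h, h2, abs_mul, abs_pow, abs_neg, abs_neg]
  simpa using abs_signedCount_le (lowBoard 0 (b + 1) + {3})

/-! ### The surviving board carries few of the games -/

theorem card_games_lowBoard_add_three (i b : ℕ) :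
    (games (lowBoard 0 (b + i) + {3})).card ≤ (games (lowBoard (2 * i) b + {3})).card := by
  induction i generalizing b with
  | zero => simp
  | succ i ih =>
    refine le_trans ?_ (card_games_play_le (m := C₁) ?_)
    · rw [show 2 * (i + 1) = 2 * i + 2 by ring, lowBoard_add_two_left, add_assoc, play_C₁]
      have h : lowBoard (2 * i) b + {3} + {2} = lowBoard (2 * i) (b + 1) + {3} := by
        rw [add_right_comm]
        simp [lowBoard, Multiset.replicate_succ, Multiset.add_cons, add_comm _ ({2} : Multiset ℕ)]
      rw [h, ← add_assoc b, add_right_comm b]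
      exact ih (b + 1)
    · rw [show 2 * (i + 1) = 2 * i + 2 by ring, lowBoard_add_two_left, add_assoc]
      exact playable_C₁ _

/-- A sequence of `i` moves `C₁` and one move `C₂` leads from the larger board to the smaller one
wherever the `C₂` is placed. The `i + 1` placements give disjoint sets of games. The induction
splits according to whether `C₂` or `C₁` comes first. -/
theorem mul_card_games_le (i b : ℕ) :
    (i + 1) * (games (lowBoard 0 (b + i) + {3})).card ≤
      (games (lowBoard (2 * i + 1) (b + 1))).card := by
  induction i generalizing b with
  | zero =>
    simpa [play_lowBoard_C₂] using
      card_games_play_le (playable_lowBoard_C₂ (a := 1) (b := b + 1).2 (by simp))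
  | succ i ih =>
    classical
    have hp1 : Playable (lowBoard (2 * (i + 1) + 1) (b + 1)) C₁ :=
      playable_lowBoard_C₁.2 (by omega)
    have hp2 : Playable (lowBoard (2 * (i + 1) + 1) (b + 1)) C₂ :=
      playable_lowBoard_C₂.2 (by omega)
    have hsub : ({C₁, C₂} : Finset Move) ⊆ moves (lowBoard (2 * (i + 1) + 1) (b + 1)) := by
      intro m hm
      simp only [Finset.mem_insert, Finset.mem_singleton] at hm
      rcases hm with rfl | rfl
      · exact mem_moves.2 hp1
      · exact mem_moves.2 hp2
    rw [card_games ⟨C₁, mem_moves.2 hp1⟩]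
    refine le_trans ?_ (Finset.sum_le_sum_of_subset hsub)
    rw [Finset.sum_pair (by simp), play_lowBoard_C₂,
      show 2 * (i + 1) + 1 = 2 * i + 1 + 2 by ring, play_lowBoard_C₁]
    have h1 := ih (b + 1)
    have h2 := card_games_lowBoard_add_three (i + 1) b
    rw [show b + 1 + i = b + (i + 1) by ring] at h1
    rw [add_one_mul (i + 1)]
    exact add_le_add h1 h2

theorem mul_abs_signedCount_start_le {N : ℕ} (hN : 4 ≤ N) :
    ((N / 2 : ℕ) : ℤ) * |signedCount (start N)| ≤ (games (start N)).card := by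
  obtain ⟨m, rfl | rfl⟩ := Nat.even_or_odd' N
  · rw [signedCount_start_even (by omega)]
    simp
  · have hm : 2 ≤ m := by omega
    have h1 := abs_signedCount_start_odd hm
    obtain ⟨i, rfl⟩ := Nat.exists_eq_add_of_le' (show 1 ≤ m by omega)
    have h2 := mul_card_games_le i 0
    have h3 : (games (lowBoard (2 * i + 1) (0 + 1))).card ≤
        (games (start (2 * (i + 1) + 1))).card := by
      rw [start_eq_lowBoard, ← play_lowBoard_C₁]
      exact card_games_play_le (playable_lowBoard_C₁.2 (by omega))
    rw [show (2 * (i + 1) + 1) / 2 = i + 1 by omega]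
    rw [zero_add] at h2
    simp only [Nat.add_sub_cancel] at h1
    calc ((i + 1 : ℕ) : ℤ) * |signedCount (start (2 * (i + 1) + 1))|
        ≤ ((i + 1 : ℕ) : ℤ) * (games (lowBoard 0 i + {3})).card := by gcongr
      _ ≤ _ := by exact_mod_cast h2.trans h3

/-! ### Contraction under random play -/

/-- The probability of even length minus the probability of odd length under random play. -/
noncomputable def signedWeight (B : Multiset ℕ) : ℝ :=
  ∑ G ∈ games B, (-1) ^ G.length * (weight B G).toReal

theorem signedWeight_eq {B : Multiset ℕ} (h : (moves B).Nonempty) :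
    ((moves B).card : ℝ) * signedWeight B = -∑ m ∈ moves B, signedWeight (play B m) := by
  have hpos : ((moves B).card : ℝ) ≠ 0 := by
    exact_mod_cast h.card_pos.ne'
  rw [signedWeight, sum_games h, ← Finset.sum_neg_distrib, Finset.mul_sum]
  refine Finset.sum_congr rfl fun m _ => ?_
  rw [signedWeight, ← Finset.sum_neg_distrib, Finset.mul_sum]
  refine Finset.sum_congr rfl fun G _ => ?_
  rw [weight_cons, ENNReal.toReal_mul, ENNReal.toReal_inv, ENNReal.toReal_natCast, ← card_moves,
    List.length_cons, pow_succ]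
  field_simp

theorem abs_signedWeight_le_one (B : Multiset ℕ) : |signedWeight B| ≤ 1 := by
  induction hn : potential B using Nat.strong_induction_on generalizing B with
  | _ n ih =>
    subst hn
    rcases (moves B).eq_empty_or_nonempty with h | h
    · simp [signedWeight, games_of_moves_eq_empty h, weight_nil]
    · have hpos : (0 : ℝ) < (moves B).card := by exact_mod_cast h.card_pos
      have h1 : |((moves B).card : ℝ) * signedWeight B| ≤ (moves B).card := by
        rw [signedWeight_eq h, abs_neg]
        refine (Finset.abs_sum_le_sum_abs _ _).trans ?_
        refine (Finset.sum_le_card_nsmul _ _ 1 fun m hm => ?_).trans (by simp)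
        exact ih _ (potential_play (mem_moves.1 hm)) _ rfl
      rw [abs_mul, abs_of_pos hpos] at h1
      exact (mul_le_iff_le_one_right hpos).1 h1

/-- One step of the recursion, with the moves outside `s` estimated trivially. -/
theorem card_mul_abs_signedWeight_le {B : Multiset ℕ} {s : Finset Move} {A a : ℝ}
    (hs : s ⊆ moves B) (hne : s.Nonempty)
    (hA : ∀ m, Playable B m → |signedWeight (play B m)| ≤ A)
    (ha : |∑ m ∈ s, signedWeight (play B m)| ≤ a) :
    ((moves B).card : ℝ) * |signedWeight B| ≤ ((moves B).card - s.card) * A + a := by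
  classical
  have h : ((moves B).card : ℝ) * |signedWeight B| = |∑ m ∈ moves B, signedWeight (play B m)| := by
    rw [← abs_neg (∑ m ∈ moves B, _), ← signedWeight_eq (hne.mono hs), abs_mul, Nat.abs_cast]
  rw [h, ← Finset.sum_sdiff hs]
  refine (abs_add_le _ _).trans (add_le_add ?_ ha)
  refine (Finset.abs_sum_le_sum_abs _ _).trans ?_
  refine (Finset.sum_le_card_nsmul _ _ A fun m hm => ?_).trans ?_
  · exact hA m (mem_moves.1 (Finset.mem_sdiff.1 hm).1)
  · rw [nsmul_eq_mul, Finset.card_sdiff_of_subset hs, Nat.cast_sub (Finset.card_le_card hs)]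

/-- Playing `C₁` and `S₂` has the same effect as playing `C₂`, with one move more. This makes
contributions of opposite sign cancel on every board with four tokens of value `1`. -/
theorem abs_signedWeight_le_of_four_ones {D : Multiset ℕ} {A K : ℝ} (hA0 : 0 ≤ A) (hK : 0 < K)
    (hK₀ : ((moves ({1, 1} + ({1, 1} + D))).card : ℝ) ≤ K)
    (hK₁ : ((moves ({1, 1} + (D + {2}))).card : ℝ) ≤ K)
    (hK₂ : ((moves ({2, 2} + D)).card : ℝ) ≤ K)
    (hA₀ : ∀ m, Playable ({1, 1} + ({1, 1} + D)) m →
      |signedWeight (play ({1, 1} + ({1, 1} + D)) m)| ≤ A)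
    (hA₁ : ∀ m, Playable ({1, 1} + (D + {2})) m →
      |signedWeight (play ({1, 1} + (D + {2})) m)| ≤ A)
    (hA₂ : ∀ m, Playable ({2, 2} + D) m → |signedWeight (play ({2, 2} + D) m)| ≤ A) :
    |signedWeight ({1, 1} + ({1, 1} + D))| ≤ (1 - 2 / K ^ 3) * A := by
  have e₁ : play ({1, 1} + ({1, 1} + D)) C₁ = {1, 1} + (D + {2}) := by
    rw [play_C₁, add_assoc]
  have e₂ : play ({1, 1} + (D + {2})) C₁ = {2, 2} + D := by
    rw [play_C₁, add_assoc, add_comm]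
    rfl
  have e₃ : ({1, 1} : Multiset ℕ) + (D + {2}) = {1, 2} + (D + {1}) := by
    have : ({1, 1} : Multiset ℕ) + {2} = {1, 2} + {1} := by decide
    rw [add_comm D, ← add_assoc, this, add_assoc, add_comm {1}]
  have e₄ : play ({1, 1} + (D + {2})) C₂ = play ({2, 2} + D) S₂ := by
    rw [e₃, play_C₂, play_S₂, add_assoc]
    rfl
  have p₀ : Playable ({1, 1} + ({1, 1} + D)) C₁ := playable_C₁ _
  have p₁ : Playable ({1, 1} + (D + {2})) C₁ := playable_C₁ _
  have p₂ : Playable ({1, 1} + (D + {2})) C₂ := by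
    rw [e₃]; exact playable_C₂ _
  have p₃ : Playable ({2, 2} + D) S₂ := playable_S₂ _
  set B₀ : Multiset ℕ := {1, 1} + ({1, 1} + D)
  set B₁ : Multiset ℕ := {1, 1} + (D + {2})
  set B₂ : Multiset ℕ := {2, 2} + D
  set x := signedWeight (play B₂ S₂)
  have hx : |x| ≤ A := hA₂ S₂ p₃
  have n₀ : (1 : ℝ) ≤ (moves B₀).card := by
    exact_mod_cast Finset.card_pos.2 ⟨_, mem_moves.2 p₀⟩
  have n₁ : (1 : ℝ) ≤ (moves B₁).card := by
    exact_mod_cast Finset.card_pos.2 ⟨_, mem_moves.2 p₁⟩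
  have n₂ : (1 : ℝ) ≤ (moves B₂).card := by
    exact_mod_cast Finset.card_pos.2 ⟨_, mem_moves.2 p₃⟩
  -- the boards after two moves
  have h₂ : |x + signedWeight B₂| ≤ (2 - 2 / K) * A := by
    have hne : (moves B₂).Nonempty := ⟨_, mem_moves.2 p₃⟩
    have hs : |(∑ m ∈ moves B₂, signedWeight (play B₂ m)) - x| ≤ ((moves B₂).card - 1) * A := by
      classical
      rw [← Finset.sum_erase_eq_sub (mem_moves.2 p₃)]
      refine (Finset.abs_sum_le_sum_abs _ _).trans ?_
      refine (Finset.sum_le_card_nsmul _ _ A fun m hm => ?_).trans ?_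
      · exact hA₂ m (mem_moves.1 (Finset.mem_of_mem_erase hm))
      · rw [nsmul_eq_mul, Finset.card_erase_of_mem (mem_moves.2 p₃),
          Nat.cast_sub hne.card_pos, Nat.cast_one]
    have hrec := signedWeight_eq hne
    set n : ℝ := ((moves B₂).card : ℝ)
    have hn : n * |x + signedWeight B₂| ≤ (2 * n - 2) * A := by
      rw [← abs_of_pos (show 0 < n by linarith), ← abs_mul, abs_of_pos (show 0 < n by linarith)]
      -- The recursion for `B₂` contains `x` once with a minus sign, so only `n - 1` of the `n`
      -- copies of `x` survive.
      have : n * (x + signedWeight B₂) =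
          (n - 1) * x - ((∑ m ∈ moves B₂, signedWeight (play B₂ m)) - x) := by
        rw [mul_add, hrec]; ring
      rw [this]
      refine (abs_sub _ _).trans ?_
      rw [abs_mul, abs_of_nonneg (show 0 ≤ n - 1 by linarith)]
      nlinarith [mul_le_mul_of_nonneg_left hx (show 0 ≤ n - 1 by linarith)]
    have hn' : |x + signedWeight B₂| ≤ (2 - 2 / n) * A := by
      rw [← mul_le_mul_iff_right₀ (show 0 < n by linarith)]
      refine hn.trans (le_of_eq ?_)
      field_simp
    refine hn'.trans ?_
    gcongr
  -- the board after one move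
  have h₁ : |signedWeight B₁| ≤ (1 - 2 / K ^ 2) * A := by
    classical
    have := card_mul_abs_signedWeight_le (s := {C₂, C₁}) (a := (2 - 2 / K) * A) (B := B₁)
      (by intro m hm
          simp only [Finset.mem_insert, Finset.mem_singleton] at hm
          rcases hm with rfl | rfl <;> simpa) (by simp) hA₁
      (by rw [Finset.sum_pair (by simp), e₄, e₂]; exact h₂)
    rw [Finset.card_pair (by simp)] at this
    set n : ℝ := ((moves B₁).card : ℝ)
    have hn' : |signedWeight B₁| ≤ (1 - 2 / (K * n)) * A := by
      rw [← mul_le_mul_iff_right₀ (show 0 < n by linarith)]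
      refine this.trans (le_of_eq ?_)
      have : n ≠ 0 := by linarith
      push_cast
      field_simp
      ring
    refine hn'.trans ?_
    rw [pow_two]
    gcongr
  have h₀ := card_mul_abs_signedWeight_le (s := {C₁}) (a := (1 - 2 / K ^ 2) * A) (B := B₀)
    (by simpa using p₀) (by simp) hA₀ (by rw [Finset.sum_singleton, e₁]; exact h₁)
  rw [Finset.card_singleton] at h₀
  set n : ℝ := ((moves B₀).card : ℝ)
  have hn' : |signedWeight B₀| ≤ (1 - 2 / (K ^ 2 * n)) * A := by
    rw [← mul_le_mul_iff_right₀ (show 0 < n by linarith)]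
    refine h₀.trans (le_of_eq ?_)
    have : n ≠ 0 := by linarith
    push_cast
    field_simp
    ring
  refine hn'.trans ?_
  rw [pow_succ K 2]
  gcongr

/-! ### Boards early in the game -/

/-- Properties shared by all boards that are reached from `start N` by `t` moves. -/
structure Early (N t : ℕ) (B : Multiset ℕ) : Prop where
  sum_eq : B.sum = N
  le_card : N ≤ B.card + t
  le_count : N ≤ B.count 1 + 2 * t
  pos : ∀ v ∈ B, 1 ≤ v

theorem early_start (N : ℕ) : Early N 0 (start N) where
  sum_eq := by simp [start, F_one]
  le_card := by simp [start]
  le_count := by simp [start, F_one]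
  pos v hv := by simp [Multiset.eq_of_mem_replicate hv, F_one]

theorem sum_produced (m : Move) : m.produced.sum = m.consumed.sum := by
  cases m with
  | C k hk =>
    obtain ⟨k, rfl⟩ := Nat.exists_eq_add_of_le' hk
    rcases k with _ | k
    · rfl
    · simp [Move.produced, Move.consumed, F, Nat.fib_add_two (n := k + 1 + 1)]
  | S k hk =>
    obtain ⟨k, rfl⟩ := Nat.exists_eq_add_of_le' hk
    rcases k with _ | k
    · rfl
    · have h1 := Nat.fib_add_two (n := k + 1 + 1 + 1)
      have h2 := Nat.fib_add_two (n := k + 1 + 1)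
      have h3 : k + 1 + 2 + 1 + 1 = k + 1 + 1 + 1 + 2 := by ring
      have h4 : k + 1 + 2 + 1 = k + 1 + 1 + 1 + 1 := by ring
      simp [Move.produced, Move.consumed, F, h3, h4] at *
      omega

theorem card_consumed (m : Move) : m.consumed.card = 2 := by
  cases m <;> simp only [Move.consumed] <;> try split_ifs
  all_goals simp

theorem card_produced_pos (m : Move) : 1 ≤ m.produced.card := by
  cases m <;> simp only [Move.produced] <;> try split_ifs
  all_goals simp

theorem F_pos (k : ℕ) : 1 ≤ F k := Nat.fib_pos.2 (by omega)

theorem pos_of_mem_produced {m : Move} {v : ℕ} (hv : v ∈ m.produced) : 1 ≤ v := by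
  have : ∃ k, v = F k := by
    cases m with
    | C k hk => exact ⟨k + 1, by simpa [Move.produced] using hv⟩
    | S k hk =>
      by_cases h : k = 2
      · simp only [Move.produced, h, if_true, Multiset.insert_eq_cons, Multiset.mem_cons,
          Multiset.mem_singleton] at hv
        rcases hv with h | h <;> exact ⟨_, h⟩
      · simp only [Move.produced, h, if_false, Multiset.insert_eq_cons, Multiset.mem_cons,
          Multiset.mem_singleton] at hv
        rcases hv with h | h <;> exact ⟨_, h⟩
  obtain ⟨k, rfl⟩ := this
  exact F_pos k

theorem Early.play {N t : ℕ} {B : Multiset ℕ} (h : Early N t B) {m : Move} (hm : Playable B m) :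
    Early N (t + 1) (play B m) := by
  obtain ⟨D, rfl⟩ := Multiset.le_iff_exists_add.mp hm
  obtain ⟨h1, h2, h3, h4⟩ := h
  have c1 := card_consumed m
  have c2 := card_produced_pos m
  have c3 := Multiset.count_le_card 1 m.consumed
  rw [play_consumed_add]
  simp only [Multiset.sum_add, Multiset.card_add, Multiset.count_add, Multiset.mem_add] at *
  refine ⟨?_, ?_, ?_, ?_⟩
  · rw [Multiset.sum_add, sum_produced, ← h1, add_comm]
  · rw [Multiset.card_add]; omega
  · rw [Multiset.count_add]; omega
  · intro v hv
    rcases Multiset.mem_add.1 hv with hv | hv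
    · exact h4 v (Or.inr hv)
    · exact pos_of_mem_produced hv

/-- At least `N - t - 1` other tokens, each of value at least `1`, share the total `N`. -/
theorem Early.le_of_mem {N t : ℕ} {B : Multiset ℕ} (h : Early N t B) {v : ℕ} (hv : v ∈ B) :
    v ≤ t + 1 := by
  obtain ⟨D, rfl⟩ := Multiset.exists_cons_of_mem hv
  have h1 := h.sum_eq
  have h2 := h.le_card
  have h3 : D.card • 1 ≤ D.sum :=
    Multiset.card_nsmul_le_sum fun x hx => h.pos x (Multiset.mem_cons_of_mem hx)
  simp only [Multiset.sum_cons, Multiset.card_cons, smul_eq_mul] at *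
  omega

/-- A playable move of index `k` needs a token `F k`, which forces `k < R`; each index carries at
most one combine and one splitting move. -/
theorem Early.card_moves_le {N t R : ℕ} {B : Multiset ℕ} (h : Early N t B) (hR : t + 1 < F R) :
    (moves B).card ≤ 2 * R := by
  have key : ∀ k, F k ∈ B → k < R := fun k hk => by
    by_contra! hlt
    have := F_mono hlt
    have := h.le_of_mem hk
    omega
  calc (moves B).card ≤ (Finset.range R ×ˢ (Finset.univ : Finset Bool)).card := by
        refine Finset.card_le_card_of_injOn Move.code ?_ Move.code_injective.injOn
        intro m hm
        have hm := mem_moves.1 (Finset.mem_coe.1 hm)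
        cases m with
        | C k hk => simpa [Move.code] using key k (Multiset.mem_of_le hm (F_mem_consumed_C hk))
        | S k hk => simpa [Move.code] using key k (Multiset.mem_of_le hm (F_mem_consumed_S hk))
    _ = 2 * R := by simp [mul_comm]

/-- Each contraction looks at most three moves ahead, hence `3 * j` in the budget. The bound on `N`
keeps four tokens `1` available throughout. -/
theorem Early.abs_signedWeight_le {N R : ℕ} (hR : 1 ≤ R) (hN : 2 * F R + 4 ≤ N) (j : ℕ) {t : ℕ}
    {B : Multiset ℕ} (h : Early N t B) (ht : t + 3 * j + 1 < F R) :
    |signedWeight B| ≤ (1 - 2 / (2 * R : ℝ) ^ 3) ^ j := by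
  have hR' : (1 : ℝ) ≤ R := by exact_mod_cast hR
  have hc0 : 0 ≤ 1 - 2 / (2 * R : ℝ) ^ 3 := by
    rw [sub_nonneg, div_le_one (by positivity)]
    nlinarith [one_le_pow₀ hR' (n := 3)]
  have hc1 : 1 - 2 / (2 * R : ℝ) ^ 3 ≤ 1 := by
    have : 0 ≤ 2 / (2 * R : ℝ) ^ 3 := by positivity
    linarith
  induction j generalizing t B with
  | zero => simpa using abs_signedWeight_le_one B
  | succ j ih =>
    have hcount : 4 ≤ B.count 1 := by
      have := h.le_count
      omega
    obtain ⟨D, rfl⟩ := Multiset.le_iff_exists_add.mp (Multiset.le_count_iff_replicate_le.1 hcount)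
    rw [show Multiset.replicate 4 1 + D = {1, 1} + ({1, 1} + D) from
      (add_assoc {1, 1} {1, 1} D)] at h ⊢
    have h₁ : Early N (t + 1) ({1, 1} + (D + {2})) := by
      have := h.play (playable_C₁ _)
      rwa [play_C₁, add_assoc] at this
    have h₂ : Early N (t + 1 + 1) ({2, 2} + D) := by
      have := h₁.play (playable_C₁ _)
      rw [play_C₁, add_assoc D, add_comm D] at this
      exact this
    rw [pow_succ']
    refine abs_signedWeight_le_of_four_ones (pow_nonneg hc0 j) (by positivity) ?_ ?_ ?_ ?_ ?_ ?_
    · exact_mod_cast h.card_moves_le (by omega)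
    · exact_mod_cast h₁.card_moves_le (by omega)
    · exact_mod_cast h₂.card_moves_le (by omega)
    · exact fun m hm => ih (h.play hm) (by omega)
    · exact fun m hm => ih (h₁.play hm) (by omega)
    · exact fun m hm => ih (h₂.play hm) (by omega)

/-! ### The limits of the signed expectations -/

theorem two_pow_le_F (n : ℕ) : 2 ^ n ≤ F (2 * n) := by
  induction n with
  | zero => simp [F]
  | succ n ih =>
    have h1 := Nat.fib_add_two (n := 2 * n + 1)
    have h2 : Nat.fib (2 * n + 1) ≤ Nat.fib (2 * n + 1 + 1) := Nat.fib_mono (by omega)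
    unfold F at *
    rw [show 2 * (n + 1) + 1 = 2 * n + 1 + 2 by ring, h1, pow_succ]
    omega

theorem tendsto_signedWeight_start :
    Tendsto (fun N => signedWeight (start N)) atTop (𝓝 0) := by
  rw [Metric.tendsto_atTop]
  intro ε hε
  have hexp : Tendsto (fun n : ℕ => Real.exp (-(n : ℝ))) atTop (𝓝 0) :=
    Real.tendsto_exp_neg_atTop_nhds_zero.comp tendsto_natCast_atTop_atTop
  have hpow : Tendsto (fun n : ℕ => (n : ℝ) ^ 4 / 2 ^ n) atTop (𝓝 0) :=
    tendsto_pow_const_div_const_pow_of_one_lt 4 one_lt_two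
  -- With `R = 2 * n` the contraction factor is `1 - 1 / (32 * n ^ 3)`, so `32 * n ^ 4` iterations
  -- give at most `exp (-n)`. They use `96 * n ^ 4` moves, which fits below `2 ^ n ≤ F (2 * n)`; the
  -- constant `1 / 200` leaves room to spare.
  obtain ⟨n, h1, h2, h3⟩ := ((hexp.eventually_lt_const hε).and
    ((hpow.eventually_lt_const (show (0 : ℝ) < 1 / 200 by norm_num)).and
      (eventually_ge_atTop 1))).exists
  have hn : (1 : ℝ) ≤ n := by exact_mod_cast h3
  have h4 : 3 * (32 * n ^ 4) + 1 < F (2 * n) := by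
    refine lt_of_lt_of_le ?_ (two_pow_le_F n)
    rw [div_lt_iff₀ (by positivity)] at h2
    have : (3 * (32 * n ^ 4) + 1 : ℝ) < 2 ^ n := by
      nlinarith [one_le_pow₀ hn (n := 4)]
    exact_mod_cast this
  refine ⟨2 * F (2 * n) + 4, fun N hN => ?_⟩
  rw [dist_zero_right, Real.norm_eq_abs]
  refine lt_of_le_of_lt ?_ h1
  have h5 := (early_start N).abs_signedWeight_le (R := 2 * n) (by omega) hN (32 * n ^ 4)
    (by omega)
  refine h5.trans ?_
  set c : ℝ := 2 / (2 * (2 * n : ℕ)) ^ 3 with hc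
  have hc' : c = 1 / (32 * n ^ 3) := by
    rw [hc]; push_cast; field_simp; norm_num
  have hc1 : c ≤ 1 := by
    rw [hc', div_le_one (by positivity)]
    nlinarith [one_le_pow₀ hn (n := 3)]
  calc (1 - c) ^ (32 * n ^ 4) ≤ Real.exp (-c) ^ (32 * n ^ 4) :=
        pow_le_pow_left₀ (by linarith) (Real.one_sub_le_exp_neg c) _
    _ = Real.exp (-(n : ℝ)) := by
        rw [← Real.exp_nat_mul, hc']
        congr 1
        push_cast
        field_simp

/-- The expectation of `(-1) ^ length` under a probability measure on the games. -/
noncomputable def signedMass {N : ℕ} (p : PMF (Omega N)) : ℝ :=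
  ∑ G : Omega N, (-1) ^ G.1.length * (p G).toReal

theorem sum_omega (N : ℕ) (f : List Move → ℝ) :
    ∑ G : Omega N, f G.1 = ∑ G ∈ games (start N), f G :=
  (Finset.sum_subtype _ (fun _ => mem_games) f).symm

theorem signedMass_uniform (N : ℕ) :
    signedMass (PMF.uniformOfFintype (Omega N)) =
      signedCount (start N) / (games (start N)).card := by
  have hc : Fintype.card (Omega N) = (games (start N)).card := by
    rw [Fintype.card_of_subtype _ fun _ => mem_games]
  simp only [signedMass, PMF.uniformOfFintype_apply, ENNReal.toReal_inv, ENNReal.toReal_natCast]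
  rw [← Finset.sum_mul, sum_omega N fun G => (-1) ^ G.length, hc, signedCount, div_eq_mul_inv]
  push_cast
  rfl

theorem signedMass_randomPlay (N : ℕ) : signedMass (randomPlay N) = signedWeight (start N) :=
  sum_omega N fun G => (-1) ^ G.length * (weight (start N) G).toReal

theorem tendsto_signedMass_uniform :
    Tendsto (fun N => signedMass (PMF.uniformOfFintype (Omega N))) atTop (𝓝 0) := by
  have h : Tendsto (fun N : ℕ => 1 / ((N / 2 : ℕ) : ℝ)) atTop (𝓝 0) :=
    tendsto_one_div_atTop_nhds_zero_nat.comp (Nat.tendsto_div_const_atTop two_ne_zero)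
  refine squeeze_zero_norm' ?_ h
  filter_upwards [eventually_ge_atTop 4] with N hN
  have h1 : ((N / 2 : ℕ) : ℝ) * |(signedCount (start N) : ℝ)| ≤ (games (start N)).card := by
    rw [← Int.cast_abs, ← Int.cast_natCast, ← Int.cast_natCast (games (start N)).card]
    exact_mod_cast mul_abs_signedCount_start_le hN
  have h2 : (0 : ℝ) < (N / 2 : ℕ) := by
    have : 0 < N / 2 := by omega
    exact_mod_cast this
  rw [signedMass_uniform, Real.norm_eq_abs, abs_div, Nat.abs_cast]
  rcases (Nat.cast_nonneg (α := ℝ) (games (start N)).card).eq_or_lt with h0 | h0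
  · rw [← h0]
    simp
  · rw [div_le_div_iff₀ h0 h2]
    linarith

/-! ### From signed expectations to winning probabilities -/

theorem wins_one_iff {G : List Move} : Wins .one G ↔ Odd G.length := by
  constructor
  · rintro ⟨t, ht, hm⟩
    have : Even t := by
      by_contra h
      simp [mover, h] at hm
    rw [ht]
    exact this.add_one
  · rintro ⟨k, hk⟩
    exact ⟨2 * k, hk, by simp [mover]⟩

/-- The empty game has even length but no winner; it is excluded later by `2 ≤ N`. -/
theorem wins_two_iff {G : List Move} (hG : G ≠ []) : Wins .two G ↔ Even G.length := by
  have hpos := List.length_pos_iff.2 hG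
  constructor
  · rintro ⟨t, ht, hm⟩
    have : ¬ Even t := by
      intro h
      simp [mover, h] at hm
    rw [ht]
    exact Nat.even_add_one.2 this
  · intro h
    obtain ⟨t, ht⟩ := Nat.exists_eq_add_of_le' hpos
    rw [ht] at h
    exact ⟨t, ht, by simp [mover, Nat.even_add_one.1 h]⟩

theorem ne_nil_of_isGame_start {N : ℕ} (hN : 2 ≤ N) {G : List Move} (hG : IsGame (start N) G) :
    G ≠ [] := by
  rintro rfl
  rw [start_eq_lowBoard] at hG
  exact hG _ (playable_lowBoard_C₁.2 hN)

theorem real_toMeasure_eq_sum {N : ℕ} (p : PMF (Omega N)) (s : Set (Omega N))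
    [DecidablePred (· ∈ s)] :
    p.toMeasure.real s = ∑ G : Omega N, if G ∈ s then (p G).toReal else 0 := by
  have : MeasurableSingletonClass (Omega N) := ⟨fun _ => trivial⟩
  rw [Measure.real, PMF.toMeasure_apply_fintype, ENNReal.toReal_sum]
  · refine Finset.sum_congr rfl fun G _ => ?_
    by_cases h : G ∈ s <;> simp [h]
  · intro G _
    by_cases h : G ∈ s <;> simp [h, p.apply_ne_top]

theorem sum_toReal_eq_one {N : ℕ} (p : PMF (Omega N)) : ∑ G : Omega N, (p G).toReal = 1 := by
  rw [← ENNReal.toReal_sum fun G _ => p.apply_ne_top G, ← tsum_fintype (L := .unconditional _),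
    p.tsum_coe, ENNReal.toReal_one]

theorem real_wins_one {N : ℕ} (p : PMF (Omega N)) :
    p.toMeasure.real {G | Wins .one G.1} = (1 - signedMass p) / 2 := by
  classical
  rw [real_toMeasure_eq_sum, ← sum_toReal_eq_one p, signedMass, ← Finset.sum_sub_distrib,
    Finset.sum_div]
  refine Finset.sum_congr rfl fun G _ => ?_
  simp only [Set.mem_ofPred_eq, wins_one_iff]
  by_cases h : Odd G.1.length
  · rw [if_pos h, h.neg_one_pow]; ring
  · rw [if_neg h, (Nat.not_odd_iff_even.1 h).neg_one_pow]; ring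

theorem real_wins_two {N : ℕ} (hN : 2 ≤ N) (p : PMF (Omega N)) :
    p.toMeasure.real {G | Wins .two G.1} = (1 + signedMass p) / 2 := by
  classical
  rw [real_toMeasure_eq_sum, ← sum_toReal_eq_one p, signedMass, ← Finset.sum_add_distrib,
    Finset.sum_div]
  refine Finset.sum_congr rfl fun G _ => ?_
  simp only [Set.mem_ofPred_eq, wins_two_iff (ne_nil_of_isGame_start hN G.2)]
  by_cases h : Even G.1.length
  · rw [if_pos h, h.neg_one_pow]; ring
  · rw [if_neg h, (Nat.not_even_iff_odd.1 h).neg_one_pow]; ring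

theorem tendsto_real_wins {p : ∀ N, PMF (Omega N)}
    (h : Tendsto (fun N => signedMass (p N)) atTop (𝓝 0)) :
    Tendsto (fun N => (p N).toMeasure.real {G | Wins .one G.1}) atTop (𝓝 (1 / 2)) ∧
    Tendsto (fun N => (p N).toMeasure.real {G | Wins .two G.1}) atTop (𝓝 (1 / 2)) := by
  constructor
  · simp only [real_wins_one]
    simpa using (h.const_sub 1).div_const 2
  · have h' : Tendsto (fun N => (1 + signedMass (p N)) / 2) atTop (𝓝 (1 / 2)) := by
      simpa using (h.const_add 1).div_const 2
    refine h'.congr' ?_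
    filter_upwards [eventually_ge_atTop 2] with N hN
    rw [real_wins_two hN]

theorem tendsto_signedMass_randomPlay :
    Tendsto (fun N => signedMass (randomPlay N)) atTop (𝓝 0) := by
  simpa only [signedMass_randomPlay] using tendsto_signedWeight_start

end ZeckendorfGame

theorem theorem1p9 :
    Tendsto (fun N : ℕ => (ZeckendorfGame.mu N).real
      {G | ZeckendorfGame.Wins ZeckendorfGame.Player.one G.1}) atTop (𝓝 (1 / 2)) ∧
    Tendsto (fun N : ℕ => (ZeckendorfGame.mu N).real
      {G | ZeckendorfGame.Wins ZeckendorfGame.Player.two G.1}) atTop (𝓝 (1 / 2)) ∧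
    Tendsto (fun N : ℕ => (ZeckendorfGame.P N).real
      {G | ZeckendorfGame.Wins ZeckendorfGame.Player.one G.1}) atTop (𝓝 (1 / 2)) ∧
    Tendsto (fun N : ℕ => (ZeckendorfGame.P N).real
      {G | ZeckendorfGame.Wins ZeckendorfGame.Player.two G.1}) atTop (𝓝 (1 / 2)) := by
  obtain ⟨h1, h2⟩ := ZeckendorfGame.tendsto_real_wins ZeckendorfGame.tendsto_signedMass_uniform
  obtain ⟨h3, h4⟩ := ZeckendorfGame.tendsto_real_wins ZeckendorfGame.tendsto_signedMass_randomPlay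
  exact ⟨h1, h2, h3, h4⟩
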